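/- Let $\mu<\kappa\le\lambda$ be infinite cardinals with $\mu$ regular and $\kappa$ regular and uncountable. Definitions. For a cardinal $\sigma\ge\kappa$ let $P_\kappa(\sigma)=\{a\subseteq\sigma : |a|<\kappa\}$, and let $u(\kappa,\sigma)$ be the least size of a cofinal subset of $(P_\kappa(\sigma),\subseteq)$. A set $C\subseteq P_\kappa(\sigma)$ is a $\mu$-club if it is cofinal in $(P_\kappa(\sigma),\subseteq)$ and $\bigcup_{i<\mu}a_i\in C$ for every strictly $\subset$-increasing sequence $\langle a_i : i<\mu\rangle$ of members of $C$. Let $N\mu\text{-}S_{\kappa,\sigma}$ be the ideal of all $B\subseteq P_\kappa(\sigma)$ such that $B\cap C=\emptyset$ for some $\mu$-club $C\subseteq P_\kappa(\sigma)$. For an ideal $J$ on an infinite set $X$, let $J^+=\{A\subseteq X : A\notin J\}$, $J^*=\{A\subseteq X : X\setminus A\in J\}$ and, for $B\in J^+$, $J|B=\{A\subseteq X : A\cap B\in J\}$. For a cardinal $\rho$, $J$ is weakly $\rho$-saturated if there is no family $Q\subseteq J^+$ of pairwise disjoint sets with $|Q|=\rho$; $J$ is nowhere weakly $\rho$-saturated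 if for every $B\in J^+$, $J|B$ is not weakly $\rho$-saturated. An ideal $K_1$ on $X_1$ is isomorphic to an ideal $K_2$ on $X_2$ if there are $W_1\in K_1^*$, $W_2\in K_2^*$ and a bijection $k:W_1\to W_2$ such that $\{D\subseteq W_1 : D\in K_1^*\}=\{D\subseteq W_1 : k[D]\in K_2^*\}$. Proposition 4.10. Suppose that $N\mu\text{-}S_{\kappa,\lambda}$ is isomorphic to $N\mu\text{-}S_{\kappa,u(\kappa,\lambda)}$. Then $N\mu\text{-}S_{\kappa,\lambda}$ is nowhere weakly $u(\kappa,\lambda)$-saturated. -/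

import Mathlib

universe u v

namespace PKappa

open Cardinal Set

/-! ### Ideals on a set, given as collections of subsets -/

/-- `J⁺`: the subsets of `X` that do not belong to `J`. -/
def Positive {X : Type u} (J : Set (Set X)) : Set (Set X) := {A | A ∉ J}

/-- `J*`: the subsets of `X` whose complement belongs to `J`. -/
def Dual {X : Type u} (J : Set (Set X)) : Set (Set X) := {A | Aᶜ ∈ J}

/-- `J | A = {B ⊆ X : B ∩ A ∈ J}`. -/
def Restrict {X : Type u} (J : Set (Set X)) (A : Set X) : Set (Set X) := {B | B ∩ A ∈ J}

/-- `K₁` is isomorphic to `K₂`: there are `W₁ ∈ K₁*`, `W₂ ∈ K₂*` and a bijection `k : W₁ → W₂`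
such that `K₁* ∩ P(W₁) = {D ⊆ W₁ : k '' D ∈ K₂*}`. The bijection is written as a map on `X₁`, of
which only the values on `W₁` matter. -/
def Isomorphic {X₁ : Type u} {X₂ : Type v} (K₁ : Set (Set X₁)) (K₂ : Set (Set X₂)) : Prop :=
  ∃ W₁ ∈ Dual K₁, ∃ W₂ ∈ Dual K₂, ∃ k : X₁ → X₂, BijOn k W₁ W₂ ∧
    Dual K₁ ∩ 𝒫 W₁ = {D | D ⊆ W₁ ∧ k '' D ∈ Dual K₂}

/-- `J` is `Y`-`ρ`-saturated: no `Q ⊆ J⁺` of size `ρ` is such that `A ∩ B ∈ Y` for any two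
distinct members `A`, `B` of `Q`. -/
def Saturated {X : Type u} (J Y : Set (Set X)) (ρ : Cardinal.{u}) : Prop :=
  ¬ ∃ Q : Set (Set X), Q ⊆ Positive J ∧ #Q = ρ ∧ ∀ A ∈ Q, ∀ B ∈ Q, A ≠ B → A ∩ B ∈ Y

/-- `J` is weakly `ρ`-saturated: it is `{∅}`-`ρ`-saturated. -/
def WeaklySaturated {X : Type u} (J : Set (Set X)) (ρ : Cardinal.{u}) : Prop :=
  Saturated J {∅} ρ

/-- `J` is nowhere weakly `ρ`-saturated: `J | B` is not weakly `ρ`-saturated for any `B ∈ J⁺`. -/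
def NowhereWeaklySaturated {X : Type u} (J : Set (Set X)) (ρ : Cardinal.{u}) : Prop :=
  ∀ B ∈ Positive J, ¬ WeaklySaturated (Restrict J B) ρ

/-! ### The space `P_κ(σ)` and its `μ`-clubs -/

/-- `P_κ(σ)`: the subsets of `σ` of size less than `κ`, ordered by inclusion. The cardinal `σ` is
identified with the well-ordered set of the ordinals below its initial ordinal. -/
abbrev P (κ σ : Cardinal.{u}) : Type u := {a : Set σ.ord.ToType // #a < κ}

/-- `u(κ, σ)`: the least size of a cofinal subset of `(P_κ(σ), ⊆)`. -/
noncomputable def cofNumber (κ σ : Cardinal.{u}) : Cardinal.{u} := Order.cof (P κ σ)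

/-- `A ⊆ P_κ(σ)` is `μ`-closed: the union of every strictly increasing sequence
`⟨a_i : i < μ⟩` of members of `A` is a member of `A`. -/
def IsMuClosed (μ : Cardinal.{u}) {κ σ : Cardinal.{u}} (A : Set (P κ σ)) : Prop :=
  ∀ a : μ.ord.ToType → P κ σ, (∀ i, a i ∈ A) → StrictMono a →
    ∃ b ∈ A, (b : Set σ.ord.ToType) = ⋃ i, (a i : Set σ.ord.ToType)

/-- A `μ`-club is a `μ`-closed cofinal subset of `P_κ(σ)`. -/
def IsMuClub (μ : Cardinal.{u}) {κ σ : Cardinal.{u}} (C : Set (P κ σ)) : Prop :=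
  IsMuClosed μ C ∧ IsCofinal C

/-- `Nμ-S_{κ,σ}`: the sets `B ⊆ P_κ(σ)` that are disjoint from some `μ`-club. -/
def NS (μ κ σ : Cardinal.{u}) : Set (Set (P κ σ)) :=
  {B | ∃ C : Set (P κ σ), IsMuClub μ C ∧ B ∩ C = ∅}

end PKappa

/-! For every σ ≥ κ, each positive subset of P_κ(σ) splits into σ disjoint positive sets
(`splits_NS`). With σ = u(κ,λ), which is at least λ ≥ κ (`le_cofNumber`), this gives u(κ,λ) pieces
on the larger space, and the isomorphism pulls them back to P_κ(λ) (`Isomorphic.splits`). For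
regular σ the splitting is a pressing-down argument resting on diagonal intersections
(`isMuClub_diagonal`): almost every a has a μ-sequence cofinal in its trace on σ, and some
coordinate of it takes σ values positively often. A singular σ is reached by gluing splittings of
smaller sizes. -/

namespace PKappa

open Cardinal Set Order

/-! ### μ-clubs and their diagonal intersections -/

section Basic

variable {μ κ σ : Cardinal.{u}}

/-- The union of fewer than `κ` members of `P_κ(σ)`, for regular `κ`. -/
def iUnionOf (hκ : κ.IsRegular) {ι : Type u} (hι : #ι < κ) (f : ι → P κ σ) : P κ σ :=
  ⟨⋃ i, (f i : Set σ.ord.ToType), (card_iUnion_lt_iff_forall_of_isRegular hκ hι).2 fun i ↦ (f i).2⟩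

theorem le_iUnionOf (hκ : κ.IsRegular) {ι : Type u} (hι : #ι < κ) (f : ι → P κ σ) (i : ι) :
    f i ≤ iUnionOf hκ hι f :=
  subset_iUnion (fun i ↦ (f i : Set σ.ord.ToType)) i

/-- Adding one point to a member of `P_κ(σ)`. -/
def insertPt (hκ : κ.IsRegular) (x : σ.ord.ToType) (a : P κ σ) : P κ σ :=
  ⟨insert x a.1, mk_insert_le.trans_lt
    (add_lt_of_lt hκ.aleph0_le a.2 (hκ.nat_lt 1 |>.trans_eq' (by simp)))⟩

theorem le_insertPt (hκ : κ.IsRegular) (x : σ.ord.ToType) (a : P κ σ) : a ≤ insertPt hκ x a :=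
  subset_insert x a.1

theorem exists_gt_of_le (hκ : κ.IsRegular) (hκσ : κ ≤ σ) (a : P κ σ) : ∃ b, a < b := by
  have h : ∃ x, x ∉ a.1 := by
    by_contra! h
    have h1 : #a.1 = σ := by rw [eq_univ_of_forall h]; simp
    exact absurd a.2 (by rw [h1]; exact hκσ.not_gt)
  obtain ⟨x, hx⟩ := h
  refine ⟨insertPt hκ x a, lt_of_le_of_ne (le_insertPt hκ x a) fun h ↦ hx ?_⟩
  rw [h]
  exact mem_insert x a.1

theorem mk_toType_lt (hμκ : μ < κ) : #μ.ord.ToType < κ := by simpa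

theorem isMuClosed_univ (hκ : κ.IsRegular) (hμκ : μ < κ) :
    IsMuClosed μ (univ : Set (P κ σ)) := fun a _ _ ↦
  ⟨iUnionOf hκ (mk_toType_lt hμκ) a, mem_univ _, rfl⟩

theorem isMuClub_univ (hκ : κ.IsRegular) (hμκ : μ < κ) : IsMuClub μ (univ : Set (P κ σ)) :=
  ⟨isMuClosed_univ hκ hμκ, .univ⟩

/-- A strictly increasing `μ`-sequence which is eventually in a `μ`-closed set has its union
there. -/
theorem IsMuClosed.mem_of_eventually (hμ : μ.IsRegular) {C : Set (P κ σ)} (hC : IsMuClosed μ C)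
    {a : μ.ord.ToType → P κ σ} (ha : StrictMono a) (i₀ : μ.ord.ToType)
    (h : ∀ i, i₀ ≤ i → a i ∈ C) {b : P κ σ} (hb : b.1 = ⋃ i, (a i).1) : b ∈ C := by
  have : IsRegularCardinalOrder μ.ord.ToType :=
    ⟨by rw [Ordinal.type_toType, Ordinal.cof_toType, hμ.cof_ord]⟩
  have hcof : IsCofinal (Ici i₀) := fun x ↦ ⟨max x i₀, mem_Ici.2 (le_max_right _ _), le_max_left _ _⟩
  -- As μ is regular, the tail from i₀ again has order type μ.
  let e := Order.enum (Ici i₀) hcof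
  obtain ⟨b', hb', hb'e⟩ := hC (fun i ↦ a (e i)) (fun i ↦ h _ (e i).2)
    (fun i j hij ↦ ha (e.strictMono hij))
  have : b = b' := by
    apply Subtype.ext
    rw [hb, hb'e]
    apply subset_antisymm
    · refine iUnion_subset fun i ↦ ?_
      refine (show (a i).1 ⊆ (a (max i i₀)).1 from ha.monotone (le_max_left _ _)).trans ?_
      have h2 := subset_iUnion (fun i ↦ (a (e i)).1) (e.symm ⟨max i i₀, mem_Ici.2 (le_max_right _ _)⟩)
      simpa using h2
    · exact iUnion_subset fun i ↦ subset_iUnion (fun i ↦ (a i).1) (e i)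
  rwa [this]

/-- Iterating an inflationary operation `μ` times, taking unions at limits. -/
theorem exists_iterate (hκ : κ.IsRegular) (hμκ : μ < κ) (F : P κ σ → P κ σ) (a₀ : P κ σ) :
    ∃ t : μ.ord.ToType → P κ σ, (∀ i, a₀ ≤ t i) ∧ ∀ i j, i < j → F (t i) ≤ t j := by
  have hι (i : μ.ord.ToType) : #(Option (Iio i)) < κ := by
    rw [mk_option]
    exact add_lt_of_lt hκ.aleph0_le ((mk_subtype_le _).trans_lt (mk_toType_lt hμκ))
      (hκ.nat_lt 1 |>.trans_eq' (by simp))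
  let step (i : μ.ord.ToType) (f : ∀ j, j < i → P κ σ) : P κ σ :=
    iUnionOf hκ (hι i) fun o ↦ o.elim a₀ fun j ↦ F (f j.1 j.2)
  let T := (wellFounded_lt (α := μ.ord.ToType)).fix step
  have hfix (i) : T i = step i fun j _ ↦ T j :=
    (wellFounded_lt (α := μ.ord.ToType)).fix_eq step i
  refine ⟨T, fun i ↦ ?_, fun i j hij ↦ ?_⟩
  · rw [hfix]
    exact le_iUnionOf hκ (hι i) (fun o ↦ o.elim a₀ fun j ↦ F (T j.1)) none
  · rw [hfix j]
    exact le_iUnionOf hκ (hι j) (fun o ↦ o.elim a₀ fun j ↦ F (T j.1)) (some ⟨i, hij⟩)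

/-- Diagonal intersections of `μ`-clubs are `μ`-clubs. The index set attached to `a ∈ P_κ(σ)` is
`I a`. -/
theorem isMuClub_diagonal (hμ : μ.IsRegular) (hκ : κ.IsRegular) (hμκ : μ < κ) (hκσ : κ ≤ σ)
    {ι : Type u} (I : P κ σ → Set ι) (hI : ∀ a, #(I a) < κ) (hmono : Monotone I)
    (hcont : ∀ (a : μ.ord.ToType → P κ σ) (b : P κ σ), b.1 = ⋃ i, (a i).1 → I b ⊆ ⋃ i, I (a i))
    (C : ι → Set (P κ σ)) (hC : ∀ x, IsMuClub μ (C x)) :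
    IsMuClub μ {a | ∀ x ∈ I a, a ∈ C x} := by
  refine ⟨fun a haC ha ↦ ?_, fun a₀ ↦ ?_⟩
  · refine ⟨iUnionOf hκ (mk_toType_lt hμκ) a, fun x hx ↦ ?_, rfl⟩
    obtain ⟨i₀, hi₀⟩ := mem_iUnion.1 (hcont a _ rfl hx)
    exact (hC x).1.mem_of_eventually hμ ha i₀
      (fun i hi ↦ haC i x (hmono (ha.monotone hi) hi₀)) rfl
  · have hc (x : ι) (a : P κ σ) : ∃ c ∈ C x, a < c := by
      obtain ⟨b, hb⟩ := exists_gt_of_le hκ hκσ a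
      obtain ⟨c, hc, hbc⟩ := (hC x).2 b
      exact ⟨c, hc, hb.trans_le hbc⟩
    choose c hcC hlt using hc
    choose g hg using exists_gt_of_le (σ := σ) hκ hκσ
    have hι (a : P κ σ) : #(Option (I a)) < κ := by
      rw [mk_option]
      exact add_lt_of_lt hκ.aleph0_le (hI a) (hκ.nat_lt 1 |>.trans_eq' (by simp))
    -- The term `g a` keeps the iteration strictly increasing even if `I a` is empty.
    let F (a : P κ σ) : P κ σ := iUnionOf hκ (hι a) fun o ↦ o.elim (g a) fun x ↦ c x a
    have hgF (a) : g a ≤ F a :=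
      le_iUnionOf hκ (hι a) (fun o ↦ o.elim (g a) fun x : I a ↦ c x a) none
    have hcF (a) (x) (hx : x ∈ I a) : c x a ≤ F a :=
      le_iUnionOf hκ (hι a) (fun o ↦ o.elim (g a) fun x : I a ↦ c x a) (some ⟨x, hx⟩)
    obtain ⟨t, ht₀, ht⟩ := exists_iterate hκ hμκ F a₀
    have htm : StrictMono t := fun i j hij ↦ (hg _).trans_le ((hgF _).trans (ht i j hij))
    have := noMaxOrder hμ.aleph0_le
    have : Nonempty μ.ord.ToType := by simpa using hμ.ne_zero
    let b := iUnionOf hκ (mk_toType_lt hμκ) t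
    refine ⟨b, fun x hx ↦ ?_, (ht₀ (Classical.arbitrary _)).trans (le_iUnionOf hκ _ t _)⟩
    obtain ⟨i₀, hi₀⟩ := mem_iUnion.1 (hcont t b rfl hx)
    classical
    -- Interleaving: t i ≤ s i ≤ t j for i < j, so s has the same union b as t, while its tail lies
    -- in `C x`.
    let s (i : μ.ord.ToType) : P κ σ := if i₀ ≤ i then c x (t i) else t i
    have hts (i) : t i ≤ s i := by
      by_cases h : i₀ ≤ i
      · simp only [s, if_pos h]; exact (hlt x _).le
      · simp only [s, if_neg h]; exact le_rfl
    have hst (i j) (hij : i < j) : s i ≤ t j := by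
      by_cases h : i₀ ≤ i
      · simp only [s, if_pos h]
        exact (hcF _ x (hmono (htm.monotone h) hi₀)).trans (ht i j hij)
      · simp only [s, if_neg h]; exact (htm hij).le
    have hsm : StrictMono s := by
      intro i j hij
      by_cases h : i₀ ≤ j
      · refine (hst i j hij).trans_lt ?_
        simp only [s, if_pos h]; exact hlt x _
      · have h' : ¬ i₀ ≤ i := fun h' ↦ h (h'.trans hij.le)
        simp only [s, if_neg h, if_neg h']; exact htm hij
    refine (hC x).1.mem_of_eventually hμ hsm i₀ (fun i hi ↦ ?_) ?_
    · simp only [s, if_pos hi]; exact hcC x _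
    · apply subset_antisymm
      · exact iUnion_subset fun i ↦ Subset.trans (hts i) (subset_iUnion (fun i ↦ (s i).1) i)
      · refine iUnion_subset fun i ↦ ?_
        obtain ⟨j, hj⟩ := exists_gt i
        exact (hst i j hj).trans (le_iUnionOf hκ _ t j)

/-- A diagonal intersection with a constant two-point index set. -/
theorem IsMuClub.inter (hμ : μ.IsRegular) (hκ : κ.IsRegular) (hμκ : μ < κ) (hκσ : κ ≤ σ)
    {C D : Set (P κ σ)} (hC : IsMuClub μ C) (hD : IsMuClub μ D) : IsMuClub μ (C ∩ D) := by
  have hne : Nonempty μ.ord.ToType := by simpa using hμ.ne_zero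
  have h := isMuClub_diagonal hμ hκ hμκ hκσ (ι := ULift.{u} Bool) (fun _ ↦ univ)
    (fun _ ↦ (lt_aleph0_of_finite _).trans_le hκ.aleph0_le) (fun _ _ _ ↦ le_rfl)
    (fun _ _ _ ↦ by simp [iUnion_const]) (fun x ↦ if x.down then C else D)
    (fun x ↦ by cases x.down <;> simpa)
  convert h using 1
  ext a
  simp [ULift.forall, and_comm]

theorem isMuClub_Ici (hκ : κ.IsRegular) (hμ : μ.IsRegular) (hμκ : μ < κ) (c : P κ σ) :
    IsMuClub μ (Ici c) := by
  have hne : Nonempty μ.ord.ToType := by simpa using hμ.ne_zero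
  refine ⟨fun a ha _ ↦ ⟨iUnionOf hκ (mk_toType_lt hμκ) a, ?_, rfl⟩, fun a ↦ ?_⟩
  · exact (ha (Classical.arbitrary _)).trans (le_iUnionOf hκ _ a _)
  · have h2 : #(ULift.{u} Bool) < κ := (lt_aleph0_of_finite _).trans_le hκ.aleph0_le
    let f : ULift.{u} Bool → P κ σ := fun x ↦ if x.down then a else c
    exact ⟨iUnionOf hκ h2 f, le_iUnionOf hκ h2 f ⟨false⟩, le_iUnionOf hκ h2 f ⟨true⟩⟩

/-- `κ ≤ σ` implies `σ ≤ u(κ, σ)`. -/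
theorem le_cofNumber (hκ : κ.IsRegular) (hκσ : κ ≤ σ) : σ ≤ cofNumber κ σ := by
  refine Order.le_cof_iff.2 fun S hS ↦ ?_
  have hcov : (⋃ s : S, s.1.1) = Set.univ := by
    refine eq_univ_of_forall fun x ↦ ?_
    have h1 : #({x} : Set σ.ord.ToType) < κ := by simpa using hκ.nat_lt 1
    obtain ⟨s, hs, hxs⟩ := hS ⟨{x}, h1⟩
    exact mem_iUnion.2 ⟨⟨s, hs⟩, hxs rfl⟩
  have hmk : #(⋃ s : S, s.1.1) = σ := by rw [hcov]; simp
  -- Fewer than κ sets of size below κ cannot cover σ, by regularity of κ.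
  have hκS : κ ≤ #S := by
    by_contra! h
    exact (hκσ.trans_eq hmk.symm).not_gt
      ((card_iUnion_lt_iff_forall_of_isRegular hκ h).2 fun s ↦ s.1.2)
  calc σ = #(⋃ s : S, s.1.1) := hmk.symm
    _ ≤ sum fun s : S ↦ #s.1.1 := mk_iUnion_le_sum_mk
    _ ≤ sum fun _ : S ↦ κ := sum_le_sum _ _ fun s ↦ s.1.2.le
    _ = #S * κ := by simp
    _ = #S := mul_eq_left (hκ.aleph0_le.trans hκS) hκS hκ.ne_zero

end Basic

/-! ### Splitting positive sets -/

section Splitting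

/-- `B` has at least `ρ` pairwise disjoint `J`-positive subsets. -/
def Splits {X : Type u} (J : Set (Set X)) (B : Set X) (ρ : Cardinal.{u}) : Prop :=
  ∃ (ι : Type u) (f : ι → Set X), ρ ≤ #ι ∧ (∀ i, f i ⊆ B ∧ f i ∈ Positive J) ∧
    Pairwise fun i j ↦ Disjoint (f i) (f j)

theorem Splits.not_weaklySaturated {X : Type u} {J : Set (Set X)} {B : Set X} {ρ : Cardinal.{u}}
    (h : Splits J B ρ) (h0 : ∅ ∈ J) : ¬ WeaklySaturated (Restrict J B) ρ := by
  obtain ⟨ι, f, hρ, hf, hd⟩ := h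
  have hinj : Function.Injective f := fun i j hij ↦ by
    by_contra hne
    have h1 : Disjoint (f i) (f j) := hd hne
    rw [← hij, disjoint_self] at h1
    exact (hf i).2 (by rw [h1]; exact h0)
  rw [← mk_range_eq f hinj] at hρ
  obtain ⟨Q, hQ, hcard⟩ := le_mk_iff_exists_subset.1 hρ
  refine fun hsat ↦ hsat ⟨Q, fun A hA ↦ ?_, hcard, fun A hA A' hA' hne ↦ ?_⟩
  · obtain ⟨i, rfl⟩ := hQ hA
    intro hmem
    refine (hf i).2 ?_
    rwa [Restrict, mem_ofPred_eq, inter_eq_left.2 (hf i).1] at hmem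
  · obtain ⟨i, rfl⟩ := hQ hA
    obtain ⟨j, rfl⟩ := hQ hA'
    exact (hd fun h ↦ hne (congrArg f h)).inter_eq

theorem Splits.mono {X : Type u} {J : Set (Set X)} {B : Set X} {ρ ρ' : Cardinal.{u}}
    (h : Splits J B ρ) (hle : ρ' ≤ ρ) : Splits J B ρ' := by
  obtain ⟨ι, f, hρ, hf⟩ := h
  exact ⟨ι, f, hle.trans hρ, hf⟩

/-- Splitting each of the pieces of a splitting once more. -/
theorem Splits.sum {X : Type u} {J : Set (Set X)} {B : Set X} {S : Type u} {ρ : S → Cardinal.{u}}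
    (hB : Splits J B #S) (h : ∀ A ⊆ B, A ∈ Positive J → ∀ s, Splits J A (ρ s)) :
    Splits J B (Cardinal.sum ρ) := by
  obtain ⟨ι, f, hρ, hf, hd⟩ := hB
  obtain ⟨e⟩ := hρ
  choose κ g hκ hg hgd using fun s ↦ h (f (e s)) (hf _).1 (hf _).2 s
  refine ⟨Σ s, κ s, fun p ↦ g p.1 p.2, ?_,
    fun p ↦ ⟨(hg p.1 p.2).1.trans (hf _).1, (hg p.1 p.2).2⟩, ?_⟩
  · rw [mk_sigma]
    exact sum_le_sum _ _ hκ
  · rintro ⟨s, x⟩ ⟨t, y⟩ hne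
    by_cases hst : s = t
    · subst hst
      exact hgd s fun hxy ↦ hne (Sigma.ext rfl (heq_of_eq hxy))
    · exact (hd fun h ↦ hst (e.injective h)).mono (hg s x).1 (hg t y).1

variable {μ κ σ : Cardinal.{u}}

theorem exists_strict_upper_bound {τ : Cardinal.{u}} (hτ : τ.IsRegular) {S : Set τ.ord.ToType}
    (hS : #S < τ) : ∃ x, ∀ y ∈ S, y < x := by
  rw [← not_isCofinal_iff]
  intro h
  have := Order.cof_le h
  rw [Ordinal.cof_toType, hτ.cof_ord] at this
  exact this.not_gt hS

/-- The members of `P_κ(σ)` whose trace on a copy of a regular `τ ≥ κ` has cofinality at most `μ`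
form a `μ`-club. -/
theorem isMuClub_cofinality (hμ : μ.IsRegular) (hκ : κ.IsRegular) (hμκ : μ < κ)
    {τ : Cardinal.{u}} (hτ : τ.IsRegular) (hκτ : κ ≤ τ)
    (e : τ.ord.ToType ↪ σ.ord.ToType) :
    IsMuClub μ {a : P κ σ | ∃ s : μ.ord.ToType → τ.ord.ToType,
      (∀ i, e (s i) ∈ a.1) ∧ ∀ γ, e γ ∈ a.1 → ∃ i, γ ≤ s i} := by
  have hne : Nonempty μ.ord.ToType := by simpa using hμ.ne_zero
  refine ⟨fun a haK _ ↦ ?_, fun a ↦ ?_⟩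
  · choose s hs hsc using haK
    refine ⟨iUnionOf hκ (mk_toType_lt hμκ) a, ?_, rfl⟩
    have hcard : #(μ.ord.ToType × μ.ord.ToType) = #μ.ord.ToType := by
      simp [mul_eq_self hμ.aleph0_le]
    obtain ⟨p⟩ := Cardinal.eq.1 hcard
    refine ⟨fun i ↦ s (p.symm i).1 (p.symm i).2, fun i ↦ mem_iUnion.2 ⟨_, hs _ _⟩,
      fun γ hγ ↦ ?_⟩
    obtain ⟨i, hi⟩ := mem_iUnion.1 hγ
    obtain ⟨j, hj⟩ := hsc i γ hi
    exact ⟨p (i, j), by simpa using hj⟩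
  · have hS : #(e ⁻¹' a.1) < τ :=
      ((mk_preimage_of_injective _ _ e.injective).trans_lt a.2).trans_le hκτ
    -- Adding a point above the whole trace gives it a maximum, so a constant sequence is cofinal.
    obtain ⟨x, hx⟩ := exists_strict_upper_bound hτ hS
    refine ⟨insertPt hκ (e x) a, ⟨fun _ ↦ x, fun _ ↦ mem_insert _ _, fun γ hγ ↦ ?_⟩,
      le_insertPt hκ _ a⟩
    refine ⟨Classical.arbitrary _, ?_⟩
    rcases hγ with h | h
    · exact (e.injective h).le
    · exact (hx γ h).le

/-- If every coordinate i had fewer than τ values γ with positive fiber {a ∈ B : s a i = γ},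
regularity of τ > μ would bound all these values by one β. Diagonalizing over the null fibers above
β then makes B null. -/
theorem splits_of_regular (hμ : μ.IsRegular) (hκ : κ.IsRegular) (hμκ : μ < κ)
    {τ : Cardinal.{u}} (hτ : τ.IsRegular) (hκτ : κ ≤ τ) (hτσ : τ ≤ σ) {B : Set (P κ σ)}
    (hB : B ∈ Positive (NS μ κ σ)) : Splits (NS μ κ σ) B τ := by
  have hκσ := hκτ.trans hτσ
  obtain ⟨e⟩ : Nonempty (τ.ord.ToType ↪ σ.ord.ToType) := by
    rw [← Cardinal.le_def]; simpa
  set K : Set (P κ σ) := {a | ∃ s : μ.ord.ToType → τ.ord.ToType,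
      (∀ i, e (s i) ∈ a.1) ∧ ∀ γ, e γ ∈ a.1 → ∃ i, γ ≤ s i}
  have hK : IsMuClub μ K := isMuClub_cofinality hμ hκ hμκ hτ hκτ e
  have hneτ : Nonempty τ.ord.ToType := by simpa using hτ.ne_zero
  have hex (a : P κ σ) : ∃ s : μ.ord.ToType → τ.ord.ToType, a ∈ K →
      (∀ i, e (s i) ∈ a.1) ∧ ∀ γ, e γ ∈ a.1 → ∃ i, γ ≤ s i := by
    by_cases h : a ∈ K
    · obtain ⟨s, hs⟩ := h
      exact ⟨s, fun _ ↦ hs⟩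
    · exact ⟨fun _ ↦ Classical.arbitrary _, fun h' ↦ absurd h' h⟩
  choose s hs using hex
  let Γ (i : μ.ord.ToType) : Set τ.ord.ToType :=
    {γ | {a ∈ B | s a i = γ} ∈ Positive (NS μ κ σ)}
  by_cases hΓ : ∃ i, τ ≤ #(Γ i)
  · obtain ⟨i, hi⟩ := hΓ
    refine ⟨Γ i, fun γ ↦ {a ∈ B | s a i = γ}, hi, fun γ ↦ ⟨sep_subset _ _, γ.2⟩, ?_⟩
    intro γ δ hne
    refine Set.disjoint_left.2 fun a ha ha' ↦ hne (Subtype.ext ?_)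
    exact ha.2.symm.trans ha'.2
  · push Not at hΓ
    exfalso
    obtain ⟨β, hβ⟩ := exists_strict_upper_bound hτ
      ((card_iUnion_lt_iff_forall_of_isRegular hτ
        ((mk_toType_lt hμκ).trans_le hκτ)).2 hΓ)
    have hC (p : τ.ord.ToType × μ.ord.ToType) : ∃ C : Set (P κ σ), IsMuClub μ C ∧
        (β ≤ p.1 → {a ∈ B | s a p.2 = p.1} ∩ C = ∅) := by
      by_cases h : β ≤ p.1
      · have : ¬ p.1 ∈ Γ p.2 := fun h' ↦ h.not_gt (hβ _ (mem_iUnion.2 ⟨_, h'⟩))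
        obtain ⟨C, hC, hBC⟩ := not_not.1 this
        exact ⟨C, hC, fun _ ↦ hBC⟩
      · exact ⟨Set.univ, isMuClub_univ hκ hμκ, fun h' ↦ absurd h' h⟩
    choose C hC hBC using hC
    have hD := isMuClub_diagonal hμ hκ hμκ hκσ
      (fun a ↦ (e ⁻¹' a.1) ×ˢ (Set.univ : Set μ.ord.ToType))
      (fun a ↦ by
        rw [mk_setProd]
        refine mul_lt_of_lt hκ.aleph0_le
          ((mk_preimage_of_injective _ _ e.injective).trans_lt a.2) ?_
        simpa using hμκ)
      (fun a b hab ↦ prod_mono (preimage_mono hab) le_rfl)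
      (fun a b hb p hp ↦ by
        have h1 : e p.1 ∈ b.1 := hp.1
        rw [hb] at h1
        obtain ⟨i, hi⟩ := mem_iUnion.1 h1
        exact mem_iUnion.2 ⟨i, hi, mem_univ _⟩) C hC
    have h1 : #({e β} : Set σ.ord.ToType) < κ := by simpa using hκ.nat_lt 1
    refine hB ⟨_, (hD.inter hμ hκ hμκ hκσ hK).inter hμ hκ hμκ hκσ
      (isMuClub_Ici hκ hμ hμκ ⟨{e β}, h1⟩), ?_⟩
    refine eq_empty_of_forall_notMem ?_
    rintro a ⟨haB, ⟨haD, haK⟩, haβ⟩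
    -- Since β is in the trace of a, some `s a i` ≥ β; it also lies in the trace, so a avoids the
    -- very fiber containing it.
    obtain ⟨i, hi⟩ := (hs a haK).2 β (haβ rfl)
    have h2 := haD (s a i, i) ⟨(hs a haK).1 i, mem_univ _⟩
    exact eq_empty_iff_forall_notMem.1 (hBC (s a i, i) hi) a ⟨⟨haB, rfl⟩, h2⟩

/-- For every `σ ≥ κ`, each positive set splits into `σ` disjoint positive sets. -/
theorem splits_NS (hμ : μ.IsRegular) (hκ : κ.IsRegular) (hμκ : μ < κ) (hκσ : κ ≤ σ)
    {B : Set (P κ σ)} (hB : B ∈ Positive (NS μ κ σ)) : Splits (NS μ κ σ) B σ := by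
  rcases isRegular_or_isSingular (hκ.aleph0_le.trans hκσ) with hσ | hσ
  · exact splits_of_regular hμ hκ hμκ hσ hκσ le_rfl hB
  have small (ρ : Cardinal.{u}) (hρ : ρ < σ) {A : Set (P κ σ)}
      (hA : A ∈ Positive (NS μ κ σ)) : Splits (NS μ κ σ) A ρ := by
    -- The successor of max κ ρ is a regular cardinal in [κ, σ].
    have hκlt : κ < σ := hκσ.lt_of_ne fun h ↦ hσ.not_isRegular (h ▸ hκ)
    have hlt : succ (max κ ρ) ≤ σ := succ_le_of_lt (max_lt hκlt hρ)
    have hle : max κ ρ ≤ succ (max κ ρ) := le_succ _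
    exact (splits_of_regular hμ hκ hμκ (isRegular_succ (hκ.aleph0_le.trans (le_max_left _ _)))
      ((le_max_left _ _).trans hle) hlt hA).mono ((le_max_right _ _).trans hle)
  obtain ⟨S, hS, hcard⟩ := Order.exists_cof_eq σ.ord.ToType
  rw [Ordinal.cof_toType] at hcard
  -- B is cut into cf σ pieces indexed by a cofinal S, and piece s into |Iic s| < σ parts; these
  -- initial segments cover σ.
  refine (Splits.sum (S := S) (ρ := fun s ↦ #(Iic s.1))
    (small _ (hcard ▸ hσ.cof_ord_lt) hB) fun A _ hA s ↦ small _ ?_ hA).mono ?_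
  · rw [← Iio_insert]
    exact mk_insert_le.trans_lt
      (add_lt_of_lt hσ.aleph0_le ((mk_Iio_lt _ (by simp)).trans_eq (by simp)) (by simpa using hσ.natCast_lt 1))
  · have hcov : (⋃ s : S, Iic s.1) = Set.univ := by
      refine eq_univ_of_forall fun x ↦ ?_
      obtain ⟨s, hs, hxs⟩ := hS x
      exact mem_iUnion.2 ⟨⟨s, hs⟩, hxs⟩
    calc σ = #(⋃ s : S, Iic s.1) := by rw [hcov]; simp
      _ ≤ _ := mk_iUnion_le_sum_mk

end Splitting

/-! ### Transfer along isomorphisms of ideals -/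

section Transport

/-- Isomorphisms of ideals carry splittings back. -/
theorem Isomorphic.splits {X₁ X₂ : Type u} {K₁ : Set (Set X₁)} {K₂ : Set (Set X₂)}
    (h : Isomorphic K₁ K₂) (hsub₁ : ∀ A ∈ K₁, ∀ B ⊆ A, B ∈ K₁)
    (hsub₂ : ∀ A ∈ K₂, ∀ B ⊆ A, B ∈ K₂) (hun₁ : ∀ A ∈ K₁, ∀ B ∈ K₁, A ∪ B ∈ K₁)
    (hun₂ : ∀ A ∈ K₂, ∀ B ∈ K₂, A ∪ B ∈ K₂) {ρ : Cardinal.{u}}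
    (hspl : ∀ B ∈ Positive K₂, Splits K₂ B ρ) {B : Set X₁} (hB : B ∈ Positive K₁) :
    Splits K₁ B ρ := by
  obtain ⟨W₁, hW₁, W₂, hW₂, k, hk, heq⟩ := h
  have himg {A : Set X₁} (hA : A ⊆ W₁) : k '' (W₁ \ A) = W₂ \ k '' A := by
    rw [hk.injOn.image_sdiff_subset hA, hk.image_eq]
  -- The isomorphism speaks of dual sets, so null sets are handled through complements relative to
  -- W₁ and W₂.
  have key {A : Set X₁} (hA : A ⊆ W₁) : A ∈ K₁ ↔ k '' A ∈ K₂ := by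
    have h1 : W₁ \ A ∈ Dual K₁ ∩ 𝒫 W₁ ↔ W₁ \ A ∈ {D | D ⊆ W₁ ∧ k '' D ∈ Dual K₂} := by
      rw [heq]
    have h2 : W₁ \ A ∈ Dual K₁ ↔ A ∈ K₁ := by
      rw [Dual, mem_ofPred_eq, sdiff_eq, compl_inter, compl_compl]
      exact ⟨fun h ↦ hsub₁ _ h _ subset_union_right, fun h ↦ hun₁ _ hW₁ _ h⟩
    have h3 : k '' (W₁ \ A) ∈ Dual K₂ ↔ k '' A ∈ K₂ := by
      rw [himg hA, Dual, mem_ofPred_eq, sdiff_eq, compl_inter, compl_compl]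
      exact ⟨fun h ↦ hsub₂ _ h _ subset_union_right, fun h ↦ hun₂ _ hW₂ _ h⟩
    rw [← h2, ← h3]
    exact ⟨fun h ↦ (h1.1 ⟨h, sdiff_subset⟩).2, fun h ↦ (h1.2 ⟨sdiff_subset, h⟩).1⟩
  have hBW : B ∩ W₁ ∉ K₁ := fun h ↦ hB <|
    hsub₁ _ (hun₁ _ h _ hW₁) _ fun x hx ↦ by
      by_cases hxW : x ∈ W₁
      · exact Or.inl ⟨hx, hxW⟩
      · exact Or.inr hxW
  obtain ⟨ι, f, hρ, hf, hd⟩ := hspl (k '' (B ∩ W₁)) fun h ↦ hBW ((key inter_subset_right).2 h)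
  refine ⟨ι, fun i ↦ B ∩ W₁ ∩ k ⁻¹' f i, hρ, fun i ↦ ⟨fun x hx ↦ hx.1.1, fun hmem ↦ ?_⟩,
    fun i j hij ↦ Set.disjoint_left.2 fun x hx hx' ↦ Set.disjoint_left.1 (hd hij) hx.2 hx'.2⟩
  rw [key (inter_subset_left.trans inter_subset_right), image_inter_preimage,
    inter_eq_right.2 (hf i).1] at hmem
  exact (hf i).2 hmem

variable {μ κ σ : Cardinal.{u}}

theorem NS_subset {A B : Set (P κ σ)} (hA : A ∈ NS μ κ σ) (h : B ⊆ A) : B ∈ NS μ κ σ := by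
  obtain ⟨C, hC, hAC⟩ := hA
  exact ⟨C, hC, subset_eq_empty (inter_subset_inter_left C h) hAC⟩

theorem NS_union (hμ : μ.IsRegular) (hκ : κ.IsRegular) (hμκ : μ < κ) (hκσ : κ ≤ σ)
    {A B : Set (P κ σ)} (hA : A ∈ NS μ κ σ) (hB : B ∈ NS μ κ σ) : A ∪ B ∈ NS μ κ σ := by
  obtain ⟨C, hC, hAC⟩ := hA
  obtain ⟨D, hD, hBD⟩ := hB
  refine ⟨C ∩ D, hC.inter hμ hκ hμκ hκσ hD, eq_empty_of_forall_notMem ?_⟩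
  rintro a ⟨ha | ha, haC, haD⟩
  · exact (hAC ▸ (⟨ha, haC⟩ : a ∈ A ∩ C) : a ∈ (∅ : Set _))
  · exact (hBD ▸ (⟨ha, haD⟩ : a ∈ B ∩ D) : a ∈ (∅ : Set _))

end Transport

end PKappa

theorem proposition4p10 (μ κ lam : Cardinal.{u})
    (hμ : μ.IsRegular) (hκ : κ.IsRegular) (hκ_unc : Cardinal.aleph0 < κ)
    (hμκ : μ < κ) (hκlam : κ ≤ lam)
    (hiso : PKappa.Isomorphic (PKappa.NS μ κ lam) (PKappa.NS μ κ (PKappa.cofNumber κ lam))) :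
    PKappa.NowhereWeaklySaturated (PKappa.NS μ κ lam) (PKappa.cofNumber κ lam) := by
  intro B hB
  have hκu : κ ≤ PKappa.cofNumber κ lam := hκlam.trans (PKappa.le_cofNumber hκ hκlam)
  refine PKappa.Splits.not_weaklySaturated (hiso.splits (fun A hA B h ↦ PKappa.NS_subset hA h)
    (fun A hA B h ↦ PKappa.NS_subset hA h)
    (fun A hA B hB ↦ PKappa.NS_union hμ hκ hμκ hκlam hA hB)
    (fun A hA B hB ↦ PKappa.NS_union hμ hκ hμκ hκu hA hB)
    (fun B hB ↦ PKappa.splits_NS hμ hκ hμκ hκu hB) hB) ?_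
  exact ⟨Set.univ, PKappa.isMuClub_univ hκ hμκ, Set.empty_inter _⟩
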